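/- For $n\ge 1$ let $\mathscr C_n$ be the set of $n$-cycles in the symmetric group $\mathscr S_n$ on $\{1,\dots,n\}$, equipped with the uniform probability measure. For a permutation $\nu\in\mathscr S_n$ let its degree (cyclic descent number) be $$\deg(\nu)=\#\{\,i : \nu(i)>\nu(i+1)\,\},$$ where $i$ ranges over $\{1,\dots,n\}$ and indices are taken modulo $n$ (so that $i=n$ is counted when $\nu(n)>\nu(1)$). Let $$\mu_n=\frac1{(n-1)!}\sum_{\nu\in\mathscr C_n}\deg(\nu),\qquad \sigma_n^2=\frac1{(n-1)!}\sum_{\nu\in\mathscr C_n}(\deg(\nu)-\mu_n)^2$$ be the mean and variance of the degree of a uniformly random $n$-cycle ($\sigma_n>0$ for all sufficiently large $n$), and let $$X_n=\frac{\deg|_{\mathscr C_n}-\mu_n}{\sigma_n}.$$ Then $X_n$ converges in distribution to the standard normal distribution $\mathcal N(0,1)$ as $n\to\infty$. -/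

import Mathlib

open MeasureTheory ProbabilityTheory Filter

/-- The degree (cyclic descent number) of a permutation `ν` of `n` points: the number of `i` with
`ν i > ν (i + 1)`, where `i` is taken modulo `n` (`finRotate n` is `i ↦ i + 1` modulo `n`). -/
def cyclicDegree {n : ℕ} (ν : Equiv.Perm (Fin n)) : ℕ :=
  (Finset.univ.filter fun i : Fin n => ν (finRotate n i) < ν i).card

/-- The set of `n`-cycles in the symmetric group on `n` points: the permutations having a single
cycle that passes through all the points. -/
abbrev NCycle (n : ℕ) : Type :=
  {ν : Equiv.Perm (Fin n) // ν.IsCycleOn Set.univ}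

instance NCycle.instMeasurableSpace (n : ℕ) : MeasurableSpace (NCycle n) := ⊤

instance NCycle.instDiscreteMeasurableSpace (n : ℕ) : DiscreteMeasurableSpace (NCycle n) :=
  ⟨fun _ => trivial⟩

instance NCycle.instNonempty (n : ℕ) : Nonempty (NCycle n) := by
  match n with
  | 0 => exact ⟨1, by simp; infer_instance⟩
  | 1 => exact ⟨1, by simp; infer_instance⟩
  | n + 2 =>
    refine ⟨finRotate (n + 2), ?_⟩
    have h := (isCycle_finRotate (n := n)).isCycleOn
    have hs : {x | finRotate (n + 2) x ≠ x} = Set.univ := by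
      ext x
      simp
    rwa [hs] at h

/-- The uniform probability measure on the set of `n`-cycles. -/
noncomputable def uniformNCycle (n : ℕ) : Measure (NCycle n) :=
  uniformOn Set.univ

instance uniformNCycle.instIsProbabilityMeasure (n : ℕ) :
    IsProbabilityMeasure (uniformNCycle n) :=
  isProbabilityMeasure_uniformOn Set.finite_univ Set.univ_nonempty

/-- The degree of an `n`-cycle as a real random variable. -/
def degreeRV (n : ℕ) (ν : NCycle n) : ℝ :=
  (cyclicDegree ν.1 : ℝ)

/-- The mean of the degree of a uniformly random `n`-cycle. -/
noncomputable def degreeMean (n : ℕ) : ℝ :=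
  ∫ ν, degreeRV n ν ∂(uniformNCycle n)

/-- The standard deviation of the degree of a uniformly random `n`-cycle. -/
noncomputable def degreeStdDev (n : ℕ) : ℝ :=
  Real.sqrt (variance (degreeRV n) (uniformNCycle n))

/-- The degree of a random `n`-cycle, normalized by its mean and standard deviation. -/
noncomputable def normalizedDegree (n : ℕ) (ν : NCycle n) : ℝ :=
  (degreeRV n ν - degreeMean n) / degreeStdDev n

/-!
Let `u₀, u₁, …` be independent uniform points of the circle `ℝ / ℤ`, with representatives in
`[0, 1)`. Their partial sums are again independent and uniform, so that the relative order of the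
representatives of the first `n` partial sums is a uniform random permutation. The representative
of `b - a` is the difference of the representatives of `b` and `a`, plus `1` exactly if this is a
descent; summed around a cyclic sequence the differences cancel, and the number of cyclic descents
of the partial sums is `S = ∑ k < n, circleRep (u k)` up to the closing step, that is, up to `1`.

To pass from uniform permutations to uniform `n`-cycles, merge the cycles of the permutation by a
map onto the `n`-cycles all of whose fibers have size `n`. It changes at most two values for every
cycle that it merges, which changes the degree by at most four. The number of cycles has second
moment `O((log n) ^ 2)`, whereas `S` has variance of order `n`. Hence the standardized degree of the
cycle and the standardization of `S` differ by a quantity that tends to `0` in `L²`, and the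
central limit theorem for independent identically distributed variables applies to `S`.
-/

section Standardization

variable {Ω Ω' : Type*} {mΩ : MeasurableSpace Ω} {mΩ' : MeasurableSpace Ω'}
  {P : Measure Ω} {Q : Measure Ω'} {X Y : Ω → ℝ}

/-- The random variable `X` centered and divided by its standard deviation; division by zero makes
it `0` when the variance vanishes. -/
noncomputable def standardize (P : Measure Ω) (X : Ω → ℝ) (ω : Ω) : ℝ :=
  (X ω - P[X]) / √Var[X; P]

theorem identDistrib_standardize {Z : Ω' → ℝ} (h : IdentDistrib X Z P Q) :
    IdentDistrib (standardize P X) (standardize Q Z) P Q := by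
  have hZ : standardize Q Z = (fun x : ℝ ↦ (x - P[X]) / √Var[X; P]) ∘ Z := by
    funext ω
    simp only [standardize, Function.comp_apply, h.integral_eq, h.variance_eq]
  have hu : Measurable fun x : ℝ ↦ (x - P[X]) / √Var[X; P] := by fun_prop
  rw [hZ]
  exact h.comp hu

theorem iIndepFun_standardize {ι : Type*} {X : ι → Ω → ℝ} (hindep : iIndepFun X P) :
    iIndepFun (fun i ↦ standardize P (X i)) P :=
  hindep.comp (fun i x ↦ (x - ∫ ω, X i ω ∂P) / √Var[X i; P]) fun i ↦ by fun_prop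

variable [IsProbabilityMeasure P]

theorem memLp_standardize (hX : MemLp X 2 P) : MemLp (standardize P X) 2 P := by
  simpa only [standardize, div_eq_mul_inv] using! (hX.sub (memLp_const P[X])).mul_const _

theorem integral_standardize (hX : Integrable X P) : ∫ ω, standardize P X ω ∂P = 0 := by
  simp only [standardize, integral_div, integral_sub hX (integrable_const _), integral_const,
    probReal_univ, one_smul, sub_self, zero_div]

theorem covariance_standardize (hX : Integrable X P) (hY : Integrable Y P) :
    cov[standardize P X, standardize P Y; P] = cov[X, Y; P] / (√Var[X; P] * √Var[Y; P]) := by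
  simp only [covariance, integral_standardize hX, integral_standardize hY, sub_zero]
  rw [← integral_div]
  simp only [standardize, div_mul_div_comm]

theorem variance_standardize (hX : MemLp X 2 P) (h0 : 0 < Var[X; P]) :
    Var[standardize P X; P] = 1 := by
  have hXi := hX.integrable one_le_two
  rw [← covariance_self (memLp_standardize hX).aemeasurable, covariance_standardize hXi hXi,
    covariance_self hX.aemeasurable, Real.mul_self_sqrt h0.le, div_self h0.ne']

theorem variance_le_two_mul_add (hX : MemLp X 2 P) (hY : MemLp Y 2 P) :
    Var[Y; P] ≤ 2 * Var[X; P] + 2 * Var[X - Y; P] := by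
  have h := variance_nonneg ((2 : ℝ) • X - Y) P
  rw [variance_sub (hX.const_smul _) hY, variance_smul, covariance_smul_left] at h
  rw [variance_sub hX hY]
  linarith

theorem variance_standardize_sub_le (hX : MemLp X 2 P) (hY : MemLp Y 2 P) (hX0 : 0 < Var[X; P])
    (hY0 : 0 < Var[Y; P]) :
    Var[standardize P X - standardize P Y; P] ≤ Var[X - Y; P] / (√Var[X; P] * √Var[Y; P]) := by
  rw [variance_sub (memLp_standardize hX) (memLp_standardize hY), variance_standardize hX hX0,
    variance_standardize hY hY0,
    covariance_standardize (hX.integrable one_le_two) (hY.integrable one_le_two),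
    variance_sub hX hY]
  have ha := Real.sqrt_pos.2 hX0
  have hb := Real.sqrt_pos.2 hY0
  rw [le_div_iff₀ (mul_pos ha hb)]
  have hab : 2 * (√Var[X; P] * √Var[Y; P]) ≤ Var[X; P] + Var[Y; P] := by
    nlinarith [sq_nonneg (√Var[X; P] - √Var[Y; P]), Real.sq_sqrt hX0.le, Real.sq_sqrt hY0.le]
  field_simp
  linarith

theorem variance_standardize_sub_le_of_four_mul_le (hX : MemLp X 2 P) (hY : MemLp Y 2 P)
    (hY0 : 0 < Var[Y; P]) (hclose : 4 * Var[X - Y; P] ≤ Var[Y; P]) :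
    Var[standardize P X - standardize P Y; P] ≤ 2 * (Var[X - Y; P] / Var[Y; P]) := by
  have hXY : Var[Y; P] ≤ 4 * Var[X; P] := by linarith [variance_le_two_mul_add hX hY]
  have hsqrt : √Var[Y; P] ≤ 2 * √Var[X; P] := by
    refine (Real.sqrt_le_sqrt hXY).trans_eq ?_
    rw [Real.sqrt_mul (by norm_num), show (4 : ℝ) = 2 ^ 2 by norm_num, Real.sqrt_sq zero_le_two]
  calc Var[standardize P X - standardize P Y; P]
      ≤ Var[X - Y; P] / (√Var[X; P] * √Var[Y; P]) :=
        variance_standardize_sub_le hX hY (by linarith) hY0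
    _ ≤ Var[X - Y; P] / (Var[Y; P] / 2) := by
        gcongr
        · exact variance_nonneg _ _
        · nlinarith [Real.mul_self_sqrt hY0.le, Real.sqrt_nonneg Var[Y; P]]
    _ = 2 * (Var[X - Y; P] / Var[Y; P]) := by ring

theorem variance_le_of_abs_le_two_mul_add_one {D : Ω → ℝ}
    (hX : AEStronglyMeasurable X P) (hD : MemLp D 2 P) (hle : ∀ᵐ ω ∂P, |X ω| ≤ 2 * D ω + 1) :
    Var[X; P] ≤ 8 * ∫ ω, D ω ^ 2 ∂P + 2 := by
  have hint : Integrable (fun ω ↦ 8 * D ω ^ 2 + 2) P :=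
    (hD.integrable_sq.const_mul 8).add (integrable_const 2)
  calc Var[X; P] ≤ ∫ ω, X ω ^ 2 ∂P := variance_le_expectation_sq hX
    _ ≤ ∫ ω, (8 * D ω ^ 2 + 2) ∂P := by
        refine integral_mono_of_nonneg (.of_forall fun ω ↦ sq_nonneg _) hint ?_
        filter_upwards [hle] with ω hω
        have hsq := pow_le_pow_left₀ (abs_nonneg _) hω 2
        rw [sq_abs] at hsq
        nlinarith [sq_nonneg (2 * D ω - 1)]
    _ = 8 * ∫ ω, D ω ^ 2 ∂P + 2 := by
        rw [integral_add (hD.integrable_sq.const_mul 8) (integrable_const 2), integral_const_mul,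
          integral_const, probReal_univ, one_smul]

end Standardization

section IIDSums

variable {Ω : Type*} {mΩ : MeasurableSpace Ω} {P : Measure Ω}

theorem variance_sum_of_iid {X : ℕ → Ω → ℝ} (hX : MemLp (X 0) 2 P) (hindep : iIndepFun X P)
    (hident : ∀ i, IdentDistrib (X i) (X 0) P P) (n : ℕ) :
    Var[fun ω ↦ ∑ k ∈ Finset.range n, X k ω; P] = n * Var[X 0; P] := by
  have h := IndepFun.variance_sum (s := Finset.range n)
    (fun i _ ↦ (hident i).memLp_iff.2 hX) fun i _ j _ hij ↦ hindep.indepFun hij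
  simpa [Finset.sum_fn, fun i ↦ (hident i).variance_eq] using h

theorem integral_sum_of_identDistrib {X : ℕ → Ω → ℝ} (hX : Integrable (X 0) P)
    (hident : ∀ i, IdentDistrib (X i) (X 0) P P) (n : ℕ) :
    ∫ ω, ∑ k ∈ Finset.range n, X k ω ∂P = n * ∫ ω, X 0 ω ∂P := by
  rw [integral_finsetSum _ fun k _ ↦ (hident k).integrable_iff.2 hX]
  simp [fun k ↦ (hident k).integral_eq]

end IIDSums

section Limits

variable {ι Ω Ω' : Type*} {mΩ : MeasurableSpace Ω} {mΩ' : MeasurableSpace Ω'}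
  {P : Measure Ω} [IsProbabilityMeasure P] {Q : Measure Ω'} [IsProbabilityMeasure Q] {Z : Ω' → ℝ}

theorem tendstoInMeasure_zero_of_variance {l : Filter ι} {W : ι → Ω → ℝ}
    (hW : ∀ i, MemLp (W i) 2 P) (hmean : ∀ i, P[W i] = 0)
    (hvar : Tendsto (fun i ↦ Var[W i; P]) l (nhds 0)) : TendstoInMeasure P W l 0 := by
  refine tendstoInMeasure_iff_norm.2 fun ε hε ↦ ?_
  have hbound : Tendsto (fun i ↦ ENNReal.ofReal (Var[W i; P] / ε ^ 2)) l (nhds 0) := by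
    simpa using ENNReal.tendsto_ofReal (hvar.div_const (ε ^ 2))
  refine tendsto_of_tendsto_of_tendsto_of_le_of_le tendsto_const_nhds hbound
    (fun _ ↦ zero_le) fun i ↦ ?_
  simpa [hmean] using meas_ge_le_variance_div_sq (hW i) hε

theorem tendstoInDistribution_standardize_of_variance_sub {l : Filter ι} [l.IsCountablyGenerated]
    {X Y : ι → Ω → ℝ} (hX : ∀ i, MemLp (X i) 2 P) (hY : ∀ i, MemLp (Y i) 2 P)
    (hpos : ∀ᶠ i in l, 0 < Var[Y i; P])
    (hclose : Tendsto (fun i ↦ Var[X i - Y i; P] / Var[Y i; P]) l (nhds 0))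
    (hlim : TendstoInDistribution (fun i ↦ standardize P (Y i)) l Z (fun _ ↦ P) Q) :
    TendstoInDistribution (fun i ↦ standardize P (X i)) l Z (fun _ ↦ P) Q := by
  have hXs i := memLp_standardize (hX i)
  have hYs i := memLp_standardize (hY i)
  refine tendstoInDistribution_of_tendstoInMeasure_sub _ Z hlim ?_ fun i ↦ (hXs i).aemeasurable
  refine tendstoInMeasure_zero_of_variance (fun i ↦ (hXs i).sub (hYs i)) (fun i ↦ ?_) ?_
  · refine (integral_sub ((hXs i).integrable one_le_two) ((hYs i).integrable one_le_two)).trans ?_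
    rw [integral_standardize ((hX i).integrable one_le_two),
      integral_standardize ((hY i).integrable one_le_two), sub_zero]
  · refine squeeze_zero' (.of_forall fun i ↦ variance_nonneg _ _) ?_
      (by simpa using hclose.const_mul 2)
    filter_upwards [hpos, hclose.eventually_le_const (u := 1 / 4) (by norm_num)] with i h0 h4
    refine variance_standardize_sub_le_of_four_mul_le (hX i) (hY i) h0 ?_
    rw [div_le_iff₀ h0] at h4
    linarith

theorem tendstoInDistribution_of_forall_identDistrib {Ω₁ Ω₂ : ι → Type*}
    {_ : ∀ i, MeasurableSpace (Ω₁ i)} {_ : ∀ i, MeasurableSpace (Ω₂ i)}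
    {P₁ : ∀ i, Measure (Ω₁ i)} [∀ i, IsProbabilityMeasure (P₁ i)]
    {P₂ : ∀ i, Measure (Ω₂ i)} [∀ i, IsProbabilityMeasure (P₂ i)] {l : Filter ι}
    {X : ∀ i, Ω₁ i → ℝ} {Y : ∀ i, Ω₂ i → ℝ} (hXY : ∀ i, IdentDistrib (X i) (Y i) (P₁ i) (P₂ i))
    (h : TendstoInDistribution X l Z P₁ Q) : TendstoInDistribution Y l Z P₂ Q where
  forall_aemeasurable i := (hXY i).aemeasurable_snd
  aemeasurable_limit := h.aemeasurable_limit
  tendsto := h.tendsto.congr fun i ↦ Subtype.ext (hXY i).map_eq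

theorem standardize_sum_of_iid {X : ℕ → Ω → ℝ} (hX : MemLp (X 0) 2 P) (hindep : iIndepFun X P)
    (hident : ∀ i, IdentDistrib (X i) (X 0) P P) (n : ℕ) :
    standardize P (fun ω ↦ ∑ k ∈ Finset.range n, X k ω) =
      fun ω ↦ (√n)⁻¹ * ∑ k ∈ Finset.range n, standardize P (X k) ω := by
  funext ω
  simp only [standardize, integral_sum_of_identDistrib (hX.integrable one_le_two) hident,
    variance_sum_of_iid hX hindep hident, fun k ↦ (hident k).integral_eq,
    fun k ↦ (hident k).variance_eq]
  rw [← Finset.sum_div, Finset.sum_sub_distrib, Finset.sum_const, Finset.card_range,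
    nsmul_eq_mul, Real.sqrt_mul (Nat.cast_nonneg n), inv_mul_eq_div, div_div, mul_comm (√n)]

theorem tendstoInDistribution_standardize_sum {X : ℕ → Ω → ℝ}
    (hZ : HasLaw Z (gaussianReal 0 1) Q) (hX : MemLp (X 0) 2 P) (hvar : 0 < Var[X 0; P])
    (hindep : iIndepFun X P) (hident : ∀ i, IdentDistrib (X i) (X 0) P P) :
    TendstoInDistribution (fun n : ℕ ↦ standardize P fun ω ↦ ∑ k ∈ Finset.range n, X k ω)
      atTop Z (fun _ ↦ P) Q := by
  have hmean := integral_standardize (hX.integrable one_le_two)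
  have hsq : P[standardize P (X 0) ^ 2] = 1 := by
    rw [← variance_standardize hX hvar,
      variance_of_integral_eq_zero (memLp_standardize hX).aemeasurable hmean]
    rfl
  simp only [standardize_sum_of_iid hX hindep hident]
  exact tendstoInDistribution_inv_sqrt_mul_sum hZ hmean hsq (iIndepFun_standardize hindep)
    fun k ↦ identDistrib_standardize (hident k)

end Limits

section CyclicDescents

variable {n : ℕ} {α : Type*} [LinearOrder α]

/-- The number of cyclic descents of a sequence in a linear order; `cyclicDegree` is the case of
the one-line notation of a permutation. -/
def cyclicDescents (x : Fin n → α) : ℕ :=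
  (Finset.univ.filter fun i ↦ x (finRotate n i) < x i).card

theorem cyclicDescents_le_add_hammingDist (x y : Fin n → α) :
    cyclicDescents x ≤ cyclicDescents y + 2 * hammingDist x y := by
  set D := Finset.univ.filter fun i ↦ x i ≠ y i with hD
  have hsub : (Finset.univ.filter fun i ↦ x (finRotate n i) < x i) ⊆
      (Finset.univ.filter fun i ↦ y (finRotate n i) < y i) ∪
        (D ∪ D.map (finRotate n).symm.toEmbedding) := by
    intro i hi
    by_contra! hc
    simp only [hD, Finset.mem_union, Finset.mem_filter, Finset.mem_univ, true_and,
      Finset.mem_map_equiv, Equiv.symm_symm, not_or, not_not] at hi hc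
    rw [hc.2.1, hc.2.2] at hi
    exact hc.1 hi
  have hcard := (Finset.card_le_card hsub).trans (Finset.card_union_le _ _)
  have hunion := Finset.card_union_le D (D.map (finRotate n).symm.toEmbedding)
  rw [Finset.card_map] at hunion
  have hdist : hammingDist x y = D.card := rfl
  simp only [cyclicDescents, hdist]
  omega

theorem abs_cyclicDescents_sub_le (x y : Fin n → α) :
    |(cyclicDescents x : ℝ) - cyclicDescents y| ≤ 2 * hammingDist x y := by
  have hxy := cyclicDescents_le_add_hammingDist x y
  have hyx := cyclicDescents_le_add_hammingDist y x
  rw [hammingDist_comm] at hyx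
  rw [abs_sub_le_iff, sub_le_iff_le_add', sub_le_iff_le_add']
  exact ⟨by exact_mod_cast hxy, by exact_mod_cast hyx⟩

/-- The permutation with the same relative order as `x`: `rank x i` is the position of `x i` when
the entries of `x` are listed in increasing order (ties being broken by the index). -/
def rank (x : Fin n → α) : Equiv.Perm (Fin n) := (Tuple.sort x)⁻¹

theorem rank_lt_rank_iff {x : Fin n → α} (hx : Function.Injective x) {i j : Fin n} :
    rank x i < rank x j ↔ x i < x j := by
  have hmono : StrictMono (x ∘ Tuple.sort x) :=
    (Tuple.monotone_sort x).strictMono_of_injective (hx.comp (Tuple.sort x).injective)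
  simpa [rank] using (hmono.lt_iff_lt (a := rank x i) (b := rank x j)).symm

theorem cyclicDescents_rank {x : Fin n → α} (hx : Function.Injective x) :
    cyclicDescents (rank x) = cyclicDescents x := by
  simp only [cyclicDescents, rank_lt_rank_iff hx]

theorem rank_comp_perm {x : Fin n → α} (hx : Function.Injective x) (τ : Equiv.Perm (Fin n)) :
    rank (x ∘ τ) = rank x * τ := by
  have hsort : x ∘ τ ∘ Tuple.sort (x ∘ τ) = x ∘ Tuple.sort x :=
    Tuple.unique_monotone (τ := Tuple.sort x) (σ := Tuple.sort (x ∘ τ) |>.trans τ)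
      (Tuple.monotone_sort (x ∘ τ)) (Tuple.monotone_sort x)
  have hmul : τ * Tuple.sort (x ∘ τ) = Tuple.sort x :=
    DFunLike.coe_injective (hx.comp_left hsort)
  rw [rank, rank, ← hmul, mul_inv_rev, inv_mul_cancel_right]

end CyclicDescents

section InsertPoint

open Equiv Equiv.Perm

theorem sameCycle_map {α β : Type*} {f : Perm α} {e : Perm β} {π : α → β}
    (h : ∀ z, e.SameCycle (π z) (π (f z))) {z w : α} (hzw : f.SameCycle z w) :
    e.SameCycle (π z) (π w) := by
  obtain ⟨i, rfl⟩ := hzw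
  induction i with
  | zero => exact SameCycle.refl _ _
  | succ k ih =>
    rw [add_comm, zpow_add, zpow_one, mul_apply]
    exact ih.trans (h _)
  | pred k ih =>
    have hk : (f ^ (-(k : ℤ))) z = f ((f ^ (-(k : ℤ) - 1)) z) := by
      rw [← mul_apply, ← zpow_one_add, add_sub_cancel]
    rw [hk] at ih
    exact ih.trans (h _).symm

theorem isCycleOn_univ_iff {α : Type*} {f : Perm α} :
    f.IsCycleOn Set.univ ↔ ∀ x y, f.SameCycle x y :=
  ⟨fun h x y ↦ h.2 (Set.mem_univ x) (Set.mem_univ y),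
    fun h ↦ ⟨Set.bijOn_univ.2 f.bijective, fun x _ y _ ↦ h x y⟩⟩

variable {n : ℕ}

theorem decomposeFin_symm_succ_apply_succ (q : Fin n) (e : Perm (Fin n)) (x : Fin n) :
    decomposeFin.symm (q.succ, e) x.succ = if e x = q then 0 else (e x).succ := by
  rw [decomposeFin_symm_apply_succ]
  split_ifs with h
  · rw [h, swap_apply_right]
  · exact swap_apply_of_ne_of_ne (Fin.succ_ne_zero _) fun h' ↦ h (Fin.succ_injective _ h')

theorem sameCycle_decomposeFin_symm_succ {q : Fin n} {e : Perm (Fin n)} {x y : Fin n}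
    (h : e.SameCycle x y) : (decomposeFin.symm (q.succ, e)).SameCycle x.succ y.succ := by
  set f := decomposeFin.symm (q.succ, e) with hf
  refine sameCycle_map (fun z ↦ ?_) h
  by_cases hz : e z = q
  · have hzz : (e z).succ = f (f z.succ) := by
      rw [hf, decomposeFin_symm_succ_apply_succ, if_pos hz, decomposeFin_symm_apply_zero, hz]
    rw [hzz, sameCycle_apply_right, sameCycle_apply_right]
  · have hzz : (e z).succ = f z.succ := by rw [hf, decomposeFin_symm_succ_apply_succ, if_neg hz]
    rw [hzz, sameCycle_apply_right]

theorem sameCycle_of_sameCycle_decomposeFin_symm {q : Fin n} {e : Perm (Fin n)} {x y : Fin n}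
    (h : (decomposeFin.symm (q.succ, e)).SameCycle x.succ y.succ) : e.SameCycle x y := by
  -- Sending the inserted point `0` to `q` collapses the longer cycle onto the shorter one.
  refine sameCycle_map (π := Fin.cases (motive := fun _ ↦ Fin n) q id) (fun z ↦ ?_) h
  refine Fin.cases ?_ (fun z ↦ ?_) z
  · rw [decomposeFin_symm_apply_zero]
    exact SameCycle.refl _ _
  · rw [decomposeFin_symm_succ_apply_succ]
    split_ifs with hz
    · exact hz ▸ sameCycle_apply_right.2 (SameCycle.refl _ _)
    · exact sameCycle_apply_right.2 (SameCycle.refl _ _)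

theorem isCycleOn_univ_decomposeFin_symm_succ_iff {q : Fin n} {e : Perm (Fin n)} :
    (decomposeFin.symm (q.succ, e)).IsCycleOn Set.univ ↔ e.IsCycleOn Set.univ := by
  simp only [isCycleOn_univ_iff]
  refine ⟨fun h x y ↦ sameCycle_of_sameCycle_decomposeFin_symm (h _ _), fun h ↦ ?_⟩
  have hq : ∀ x, (decomposeFin.symm (q.succ, e)).SameCycle x q.succ := by
    refine Fin.cases ?_ fun x ↦ sameCycle_decomposeFin_symm_succ (h x q)
    simpa using sameCycle_apply_right.2 (SameCycle.refl (decomposeFin.symm (q.succ, e)) 0)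
  exact fun x y ↦ (hq x).trans (hq y).symm

theorem not_isCycleOn_univ_of_apply_eq {α : Type*} [Nontrivial α] {f : Perm α} {x : α}
    (hx : f x = x) : ¬ f.IsCycleOn Set.univ := by
  obtain ⟨y, hy⟩ := exists_ne x
  exact fun h ↦ hy ((isCycleOn_univ_iff.1 h x y).eq_of_left hx).symm

/-- Insert a new point `0` into an `n`-cycle on the remaining points, just before `x.1`. -/
def NCycle.insert (x : Fin n × NCycle n) : NCycle (n + 1) :=
  ⟨decomposeFin.symm (x.1.succ, x.2.1), isCycleOn_univ_decomposeFin_symm_succ_iff.2 x.2.2⟩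

theorem NCycle.insert_bijective (n : ℕ) :
    Function.Bijective (NCycle.insert : Fin (n + 1) × NCycle (n + 1) → NCycle (n + 2)) := by
  constructor
  · rintro ⟨q, ν⟩ ⟨q', ν'⟩ h
    simpa [Subtype.ext_iff] using decomposeFin.symm.injective (congrArg Subtype.val h)
  · rintro ⟨ν, hν⟩
    obtain ⟨⟨p, e⟩, rfl⟩ := decomposeFin.symm.surjective ν
    have hp : p ≠ 0 := by
      rintro rfl
      exact not_isCycleOn_univ_of_apply_eq (decomposeFin_symm_apply_zero _ _) hν
    obtain ⟨q, rfl⟩ := Fin.exists_succ_eq.2 hp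
    exact ⟨(q, ⟨e, isCycleOn_univ_decomposeFin_symm_succ_iff.1 hν⟩), rfl⟩

theorem hammingDist_decomposeFin_symm (p : Fin (n + 1)) (e e' : Perm (Fin n)) :
    hammingDist (decomposeFin.symm (p, e)) (decomposeFin.symm (p, e')) = hammingDist e e' := by
  simp [hammingDist, Fin.card_filter_univ_succ]

theorem hammingDist_decomposeFin_symm_zero_succ_le (q : Fin n) (e e' : Perm (Fin n)) :
    hammingDist (decomposeFin.symm (0, e)) (decomposeFin.symm (q.succ, e')) ≤
      hammingDist e e' + 2 := by
  -- Besides the differences of `e` and `e'`, only `0` and its preimage under the second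
  -- permutation can contribute.
  have hsub : (Finset.univ.filter fun x : Fin n ↦
      decomposeFin.symm (0, e) x.succ ≠ decomposeFin.symm (q.succ, e') x.succ) ⊆
      insert (e'.symm q) (Finset.univ.filter fun x : Fin n ↦ e x ≠ e' x) := by
    intro x
    simp only [Finset.mem_filter, Finset.mem_univ, true_and, Finset.mem_insert, eq_symm_apply]
    rw [decomposeFin_symm_succ_apply_succ, decomposeFin_symm_apply_succ, swap_self, refl_apply]
    split_ifs with h <;> simp [h]
  have hle := (Finset.card_le_card hsub).trans (Finset.card_insert_le _ _)
  simp only [hammingDist]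
  rw [Fin.card_filter_univ_succ]
  split_ifs <;> omega

end InsertPoint

section Harmonic

theorem harmonic_add_two_cast (m : ℕ) :
    ((harmonic (m + 2) : ℚ) : ℝ) = harmonic (m + 1) + 1 / (m + 2) := by
  rw [harmonic_succ]
  push_cast
  ring

theorem harmonic_nonneg (n : ℕ) : (0 : ℝ) ≤ harmonic n := by
  rw [harmonic]
  positivity

theorem tendsto_harmonic_add_one_sq_div :
    Tendsto (fun n : ℕ ↦ ((harmonic n : ℝ) + 1) ^ 2 / n) atTop (nhds 0) := by
  have hlog : Tendsto (fun n : ℕ ↦ (2 * Real.log n ^ 2 + 8) / n) atTop (nhds 0) := by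
    have hsq := (Real.isLittleO_pow_log_id_atTop (n := 2)).tendsto_div_nhds_zero.comp
      tendsto_natCast_atTop_atTop
    simpa [add_div, mul_div_assoc] using
      (hsq.const_mul 2).add (tendsto_const_div_atTop_nhds_zero_nat (8 : ℝ))
  refine squeeze_zero (fun n ↦ by positivity) (fun n ↦ ?_) hlog
  gcongr
  have hpos := harmonic_nonneg n
  calc ((harmonic n : ℝ) + 1) ^ 2 ≤ (Real.log n + 2) ^ 2 :=
        pow_le_pow_left₀ (by linarith) (by linarith [harmonic_le_one_add_log n]) 2
    _ ≤ 2 * Real.log n ^ 2 + 8 := by linarith [sq_nonneg (Real.log n - 2)]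

end Harmonic

section MergeCycles

open Equiv Equiv.Perm

/-- The involution `(0, q) ↦ (0, q)`, `(r + 1, q) ↦ (q + 1, r)`, which in `mergeCycles` turns an
insertion place and an old mark into a new mark and an insertion place. -/
def swapSucc {n : ℕ} (x : Fin (n + 1) × Fin n) : Fin (n + 1) × Fin n :=
  Fin.cases (motive := fun _ ↦ Fin (n + 1) × Fin n) (0, x.2) (fun r ↦ (x.2.succ, r)) x.1

theorem swapSucc_involutive {n : ℕ} : Function.Involutive (swapSucc (n := n)) := by
  rintro ⟨p, q⟩
  cases p using Fin.cases <;> rfl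

/-- Merge the cycles of a permutation into a single cycle with a marked point, the mark making the
map a bijection. The points are inserted one at a time, as in `Equiv.Perm.decomposeFin`: if the new
point `0` has an image other than itself, it is inserted into the cycle built so far just before
that image, and the mark stays where it is; if `0` is a fixed point, it is inserted just before the
mark and becomes the new mark. -/
noncomputable def mergeCycles : (n : ℕ) → Perm (Fin (n + 1)) ≃ Fin (n + 1) × NCycle (n + 1)
  | 0 =>
    have : Subsingleton (Fin (0 + 1)) := Fin.subsingleton_one
    equivOfSubsingletonOfSubsingleton (fun _ ↦ (0, Classical.arbitrary _)) fun _ ↦ 1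
  | n + 1 =>
    decomposeFin.trans <| ((Equiv.refl _).prodCongr (mergeCycles n)).trans <|
      (Equiv.prodAssoc _ _ _).symm.trans <|
      (swapSucc_involutive.toPerm.prodCongr (Equiv.refl _)).trans <|
      (Equiv.prodAssoc _ _ _).trans <|
      (Equiv.refl _).prodCongr (Equiv.ofBijective _ (NCycle.insert_bijective n))

theorem mergeCycles_decomposeFin_symm_succ_snd (n : ℕ) (r : Fin (n + 1))
    (e : Perm (Fin (n + 1))) :
    (mergeCycles (n + 1) (decomposeFin.symm (r.succ, e))).2 =
      NCycle.insert (r, (mergeCycles n e).2) := by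
  simp [mergeCycles, swapSucc]

theorem mergeCycles_decomposeFin_symm_zero_snd (n : ℕ) (e : Perm (Fin (n + 1))) :
    (mergeCycles (n + 1) (decomposeFin.symm (0, e))).2 = NCycle.insert (mergeCycles n e) := by
  simp [mergeCycles, swapSucc]

/-- The number of points moved differently by a permutation and the cycle obtained from it. -/
noncomputable def mergeDist (n : ℕ) (σ : Perm (Fin (n + 1))) : ℕ :=
  hammingDist σ (mergeCycles n σ).2.1

theorem mergeDist_decomposeFin_symm_le (n : ℕ) (p : Fin (n + 2)) (e : Perm (Fin (n + 1))) :
    mergeDist (n + 1) (decomposeFin.symm (p, e)) ≤ mergeDist n e + if p = 0 then 2 else 0 := by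
  cases p using Fin.cases with
  | zero =>
    rw [mergeDist, mergeCycles_decomposeFin_symm_zero_snd, if_pos rfl]
    exact hammingDist_decomposeFin_symm_zero_succ_le _ _ _
  | succ r =>
    rw [mergeDist, mergeCycles_decomposeFin_symm_succ_snd, if_neg (Fin.succ_ne_zero r)]
    exact (hammingDist_decomposeFin_symm _ _ _).le

end MergeCycles

section MergeDistMoments

open Equiv
open scoped BigOperators

variable {α : Type*} [Fintype α] {k : ℕ} {D : α → ℝ} {D' : Fin (k + 1) → α → ℝ}

theorem expect_add_ite_eq_zero (f g : α → ℝ) :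
    𝔼 x : Fin (k + 1) × α, (f x.2 + if x.1 = 0 then g x.2 else 0) =
      𝔼 a, f a + (𝔼 a, g a) / (k + 1) := by
  have hfst : ∀ a, 𝔼 p : Fin (k + 1), (f a + if p = 0 then g a else 0) = f a + g a / (k + 1) := by
    intro a
    rw [Finset.expect_add_distrib, Fintype.expect_const, Fintype.expect_eq_sum_div_card]
    simp
  rw [← Finset.univ_product_univ, Finset.expect_product, Finset.expect_comm]
  simp only [hfst, Finset.expect_add_distrib, ← Finset.expect_div]

variable [Nonempty α]

theorem expect_le_of_le_add_ite (h : ∀ p a, D' p a ≤ D a + if p = 0 then 2 else 0) :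
    𝔼 x : Fin (k + 1) × α, D' x.1 x.2 ≤ 𝔼 a, D a + 2 / (k + 1) :=
  calc 𝔼 x : Fin (k + 1) × α, D' x.1 x.2
      ≤ 𝔼 x : Fin (k + 1) × α, (D x.2 + if x.1 = 0 then 2 else 0) :=
        Finset.expect_le_expect fun x _ ↦ h x.1 x.2
    _ = 𝔼 a, D a + 2 / (k + 1) := by
        rw [expect_add_ite_eq_zero D fun _ ↦ 2, Fintype.expect_const]

theorem expect_sq_le_of_le_add_ite (h0 : ∀ p a, 0 ≤ D' p a)
    (h : ∀ p a, D' p a ≤ D a + if p = 0 then 2 else 0) :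
    𝔼 x : Fin (k + 1) × α, D' x.1 x.2 ^ 2 ≤ 𝔼 a, D a ^ 2 + (4 * 𝔼 a, D a + 4) / (k + 1) :=
  calc 𝔼 x : Fin (k + 1) × α, D' x.1 x.2 ^ 2
      ≤ 𝔼 x : Fin (k + 1) × α, (D x.2 ^ 2 + if x.1 = 0 then 4 * D x.2 + 4 else 0) := by
        refine Finset.expect_le_expect fun x _ ↦ ?_
        refine (pow_le_pow_left₀ (h0 _ _) (h x.1 x.2) 2).trans_eq ?_
        split_ifs <;> ring
    _ = 𝔼 a, D a ^ 2 + (4 * 𝔼 a, D a + 4) / (k + 1) := by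
        rw [expect_add_ite_eq_zero (fun a ↦ D a ^ 2) fun a ↦ 4 * D a + 4,
          Finset.expect_add_distrib, Fintype.expect_const, ← Finset.mul_expect]

theorem mergeDist_zero (σ : Perm (Fin (0 + 1))) : mergeDist 0 σ = 0 :=
  hammingDist_eq_zero.2 (funext fun _ ↦ Subsingleton.elim (α := Fin 1) _ _)

theorem mergeDist_cast_decomposeFin_symm_le (m : ℕ) (p : Fin (m + 2)) (e : Perm (Fin (m + 1))) :
    (mergeDist (m + 1) (Perm.decomposeFin.symm (p, e)) : ℝ) ≤
      mergeDist m e + if p = 0 then 2 else 0 := by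
  exact_mod_cast mergeDist_decomposeFin_symm_le m p e

theorem expect_perm_succ (n : ℕ) (f : Perm (Fin (n + 1)) → ℝ) :
    𝔼 σ, f σ = 𝔼 x, f (Perm.decomposeFin.symm x) :=
  Fintype.expect_equiv Perm.decomposeFin _ _ fun σ ↦ by rw [Equiv.symm_apply_apply]

theorem expect_mergeDist_le (m : ℕ) :
    𝔼 σ, (mergeDist m σ : ℝ) ≤ 2 * harmonic (m + 1) := by
  induction m with
  | zero => simp [mergeDist_zero]
  | succ m ih =>
    have hstep := expect_le_of_le_add_ite (mergeDist_cast_decomposeFin_symm_le m)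
    rw [expect_perm_succ, harmonic_add_two_cast]
    refine hstep.trans ?_
    push_cast
    rw [add_assoc, one_add_one_eq_two]
    linarith [ih, mul_one_div (2 : ℝ) (m + 2)]

theorem expect_mergeDist_sq_le (m : ℕ) :
    𝔼 σ, (mergeDist m σ : ℝ) ^ 2 ≤ 4 * (harmonic (m + 1) + 1) ^ 2 := by
  induction m with
  | zero =>
    simp [mergeDist_zero]
  | succ m ih =>
    have hstep := expect_sq_le_of_le_add_ite (fun _ _ ↦ Nat.cast_nonneg _)
      (mergeDist_cast_decomposeFin_symm_le m)
    have hmean := expect_mergeDist_le m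
    rw [expect_perm_succ, harmonic_add_two_cast]
    refine hstep.trans ?_
    push_cast
    rw [add_assoc, one_add_one_eq_two, div_eq_mul_one_div]
    calc 𝔼 σ, (mergeDist m σ : ℝ) ^ 2 + (4 * 𝔼 σ, (mergeDist m σ : ℝ) + 4) * (1 / (m + 2))
        ≤ 4 * (harmonic (m + 1) + 1) ^ 2 + (4 * (2 * harmonic (m + 1)) + 4) * (1 / (m + 2)) := by
          gcongr
      _ ≤ 4 * (harmonic (m + 1) + 1 / (m + 2) + 1) ^ 2 := by
          have : (0 : ℝ) < 1 / (m + 2) := by positivity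
          nlinarith

end MergeDistMoments

section UniformLaws

open scoped BigOperators

theorem integral_uniformOn_univ {α : Type*} [Fintype α] [MeasurableSpace α]
    [MeasurableSingletonClass α] (f : α → ℝ) :
    ∫ a, f a ∂(uniformOn (Set.univ : Set α)) = 𝔼 a, f a := by
  rw [uniformOn, ProbabilityTheory.cond, Measure.restrict_univ, integral_smul_measure,
    integral_count, Fintype.expect_eq_sum_div_card, Measure.count_univ]
  simp [div_eq_inv_mul]

theorem eq_uniformOn_univ_of_measure_singleton_eq {α : Type*} [Finite α] [MeasurableSpace α]
    [MeasurableSingletonClass α] {μ : Measure α} [IsProbabilityMeasure μ]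
    (h : ∀ a b, μ {a} = μ {b}) : μ = uniformOn Set.univ := by
  have := Fintype.ofFinite α
  refine Measure.ext_of_singleton fun a ↦ ?_
  have hsum : Fintype.card α * μ {a} = 1 := by
    rw [← measure_univ (μ := μ), ← Finset.coe_univ, ← sum_measure_singleton]
    simp [h _ a]
  rw [uniformOn_univ, Measure.count_singleton, ENNReal.eq_div_iff _ (ENNReal.natCast_ne_top _),
    hsum]
  rintro h0
  simp [h0] at hsum

theorem measurePreserving_snd_comp_equiv {α ι β : Type*} [Finite α] [Nonempty α] [MeasurableSpace α]
    [DiscreteMeasurableSpace α] [MeasurableSpace β] [MeasurableSingletonClass β]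
    (e : α ≃ ι × β) :
    MeasurePreserving (fun a ↦ (e a).2) (uniformOn Set.univ) (uniformOn Set.univ) := by
  have := Fintype.ofFinite α
  have : Finite β := Finite.of_surjective (fun a ↦ (e a).2)
    (Prod.snd_surjective (h := ⟨(e (Classical.arbitrary α)).1⟩) |>.comp e.surjective)
  have : IsProbabilityMeasure (uniformOn (Set.univ : Set α)) :=
    isProbabilityMeasure_uniformOn Set.finite_univ Set.univ_nonempty
  have hm : Measurable fun a ↦ (e a).2 := .of_discrete
  have : IsProbabilityMeasure ((uniformOn (Set.univ : Set α)).map fun a ↦ (e a).2) :=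
    Measure.isProbabilityMeasure_map hm.aemeasurable
  have hfiber : ∀ b, (uniformOn (Set.univ : Set α)).map (fun a ↦ (e a).2) {b} =
      (Set.univ : Set ι).encard / Fintype.card α := fun b ↦ by
    have hpre : (fun a ↦ (e a).2) ⁻¹' {b} = e ⁻¹' (Set.univ ×ˢ {b}) := by
      ext a
      simp
    rw [Measure.map_apply hm (measurableSet_singleton b), uniformOn_univ,
      Measure.count_apply (.of_discrete), hpre, Set.encard_preimage_of_bijective e.bijective,
      Set.encard_prod, Set.encard_singleton, mul_one]
  exact ⟨hm, eq_uniformOn_univ_of_measure_singleton_eq fun a b ↦ by rw [hfiber, hfiber]⟩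

end UniformLaws

section AEInjective

variable {ι α : Type*} [Fintype ι] [MeasurableSpace α] [MeasurableEq α]

theorem ae_prod_ne (μ : Measure α) [SFinite μ] [NullSingletonClass μ] :
    ∀ᵐ p ∂μ.prod μ, p.1 ≠ p.2 := by
  refine (Measure.ae_prod_iff_ae_ae measurableSet_diagonal.compl).2 (.of_forall fun a ↦ ?_)
  filter_upwards [measure_eq_zero_iff_ae_notMem.1 (measure_singleton (μ := μ) a)] with b hb hab
  exact hb hab.symm

variable (μ : Measure α) [IsProbabilityMeasure μ] [NullSingletonClass μ]

theorem ae_apply_ne_apply_pi {i j : ι} (hij : i ≠ j) :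
    ∀ᵐ x ∂Measure.pi fun _ : ι ↦ μ, x i ≠ x j := by
  have heval := fun k : ι ↦ measurePreserving_eval (fun _ ↦ μ) k
  have hindep : IndepFun (fun x : ι → α ↦ x i) (fun x ↦ x j) (Measure.pi fun _ ↦ μ) :=
    (iIndepFun_pi (X := fun _ : ι ↦ id) fun _ ↦ aemeasurable_id).indepFun hij
  have hprod := (indepFun_iff_map_prod_eq_prod_map_map (heval i).aemeasurable
    (heval j).aemeasurable).1 hindep
  have hne := ae_prod_ne μ
  rw [show μ.prod μ = _ from .symm <| hprod.trans <|
    congrArg₂ Measure.prod (heval i).map_eq (heval j).map_eq] at hne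
  exact ae_of_ae_map ((heval i).measurable.prodMk (heval j).measurable).aemeasurable hne

theorem ae_injective_pi : ∀ᵐ x ∂Measure.pi fun _ : ι ↦ μ, Function.Injective x := by
  have hne : ∀ᵐ x ∂Measure.pi fun _ : ι ↦ μ, ∀ i j : ι, i ≠ j → x i ≠ x j := by
    simp only [ae_all_iff, Filter.eventually_imp_distrib_left]
    exact fun i j ↦ ae_apply_ne_apply_pi μ
  filter_upwards [hne] with x hx i j hij using by_contra fun h ↦ hx i j h hij

end AEInjective

section Ranks

instance permMeasurableSpace {α : Type*} : MeasurableSpace (Equiv.Perm α) := ⊤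

instance permDiscreteMeasurableSpace {α : Type*} : DiscreteMeasurableSpace (Equiv.Perm α) :=
  ⟨fun _ ↦ trivial⟩

variable {n : ℕ} {α : Type*} [LinearOrder α] [TopologicalSpace α] [OrderClosedTopology α]
  [SecondCountableTopology α] [MeasurableSpace α] [OpensMeasurableSpace α]

theorem measurable_rank : Measurable fun x : Fin n → α ↦ rank x := by
  refine measurable_to_countable' fun σ ↦ ?_
  have hpre : (fun x : Fin n → α ↦ rank x) ⁻¹' {σ} = {x | Monotone (x ∘ ⇑σ⁻¹) ∧
      ∀ i j, i < j → x (σ⁻¹ i) = x (σ⁻¹ j) → σ⁻¹ i < σ⁻¹ j} := by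
    ext x
    rw [Set.mem_ofPred_eq, ← Tuple.eq_sort_iff, Set.mem_preimage, Set.mem_singleton_iff, rank,
      inv_eq_iff_eq_inv, eq_comm]
  rw [hpre]
  simp only [Monotone, Function.comp_apply]
  measurability

theorem measurePreserving_rank (μ : Measure α) [IsProbabilityMeasure μ] [NullSingletonClass μ] :
    MeasurePreserving (fun x : Fin n → α ↦ rank x) (Measure.pi fun _ ↦ μ)
      (uniformOn Set.univ) := by
  have hprob := Measure.isProbabilityMeasure_map (μ := Measure.pi fun _ : Fin n ↦ μ)
    (measurable_rank (n := n) (α := α)).aemeasurable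
  refine ⟨measurable_rank, eq_uniformOn_univ_of_measure_singleton_eq fun σ τ ↦ ?_⟩
  have hcomp : MeasurePreserving (fun x : Fin n → α ↦ x ∘ ⇑(σ⁻¹ * τ))
      (Measure.pi fun _ ↦ μ) (Measure.pi fun _ ↦ μ) :=
    measurePreserving_arrowCongr' (fun _ ↦ μ) (fun _ ↦ μ) (σ⁻¹ * τ)⁻¹ (MeasurableEquiv.refl α)
      fun _ ↦ .id μ
  rw [Measure.map_apply measurable_rank (measurableSet_singleton σ),
    Measure.map_apply measurable_rank (measurableSet_singleton τ),
    ← hcomp.measure_preimage (measurable_rank (measurableSet_singleton τ)).nullMeasurableSet]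
  refine measure_congr ?_
  filter_upwards [ae_injective_pi μ] with x hx
  refine propext ?_
  change rank x = σ ↔ rank (x ∘ ⇑(σ⁻¹ * τ)) = τ
  rw [rank_comp_perm hx, ← mul_assoc, mul_eq_right, mul_inv_eq_one]

end Ranks

section PartialSums

theorem sum_Iic_eq_sum_range {M : Type*} [AddCommMonoid M] {n : ℕ} (f : ℕ → M) (i : Fin n) :
    ∑ j ∈ Finset.Iic i, f j = ∑ k ∈ Finset.range (i + 1), f k := by
  rw [Nat.range_succ_eq_Iic, ← Fin.map_valEmbedding_Iic, Finset.sum_map]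
  rfl

variable {G : Type*} [AddCommGroup G]

theorem surjective_sum_Iic (n : ℕ) :
    Function.Surjective fun (u : Fin n → G) i ↦ ∑ j ∈ Finset.Iic i, u j := by
  intro V
  let W : ℕ → G
    | 0 => 0
    | k + 1 => if h : k < n then V ⟨k, h⟩ else 0
  refine ⟨fun j ↦ W (j + 1) - W j, funext fun i ↦ ?_⟩
  refine (sum_Iic_eq_sum_range (fun k ↦ W (k + 1) - W k) i).trans ?_
  rw [Finset.sum_range_sub]
  simp [W]

variable [TopologicalSpace G] [IsTopologicalAddGroup G] [CompactSpace G]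
  [SecondCountableTopology G] [MeasurableSpace G] [BorelSpace G]

theorem measurePreserving_sum_Iic (μ : Measure G) [μ.IsAddHaarMeasure] (n : ℕ) :
    MeasurePreserving (fun (u : Fin n → G) i ↦ ∑ j ∈ Finset.Iic i, u j)
      (Measure.pi fun _ ↦ μ) (Measure.pi fun _ ↦ μ) := by
  let f : (Fin n → G) →+ (Fin n → G) :=
    { toFun := fun u i ↦ ∑ j ∈ Finset.Iic i, u j
      map_zero' := by
        funext i
        exact Finset.sum_const_zero
      map_add' := fun u v ↦ by
        funext i
        exact Finset.sum_add_distrib }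
  refine f.measurePreserving ?_ (surjective_sum_Iic n) rfl
  exact continuous_pi fun i ↦ continuous_finsetSum _ fun j _ ↦ continuous_apply j

theorem hasLaw_partialSums {Ω : Type*} {mΩ : MeasurableSpace Ω} {P : Measure Ω}
    {μ : Measure G} [μ.IsAddHaarMeasure] {u : ℕ → Ω → G} (hu : ∀ k, HasLaw (u k) μ P)
    (hindep : iIndepFun u P) (n : ℕ) :
    HasLaw (fun ω (i : Fin n) ↦ ∑ k ∈ Finset.range (i + 1), u k ω) (Measure.pi fun _ ↦ μ) P := by
  have hpi := (hindep.precomp Fin.val_injective).hasLaw_pi fun i : Fin n ↦ hu i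
  have hsum : (fun ω (i : Fin n) ↦ ∑ k ∈ Finset.range (i + 1), u k ω) =
      (fun (v : Fin n → G) i ↦ ∑ j ∈ Finset.Iic i, v j) ∘ fun ω j ↦ u j ω :=
    funext₂ fun ω i ↦ (sum_Iic_eq_sum_range (fun k ↦ u k ω) i).symm
  rw [hsum]
  exact (measurePreserving_sum_Iic μ n).hasLaw.comp hpi

end PartialSums

section Circle

instance isProbabilityMeasure_volume_unitAddCircle :
    IsProbabilityMeasure (volume : Measure UnitAddCircle) :=
  ⟨UnitAddCircle.measure_univ⟩

instance nullSingletonClass_volume_unitAddCircle :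
    NullSingletonClass (volume : Measure UnitAddCircle) := by
  refine ⟨fun x ↦ ?_⟩
  simpa using AddCircle.volume_closedBall (T := 1) (x := x) 0

/-- The representative in `[0, 1)` of a point of the circle `ℝ / ℤ`. -/
noncomputable def circleRep (x : UnitAddCircle) : ℝ := (AddCircle.equivIco 1 0 x : ℝ)

theorem circleRep_mem_Ico (x : UnitAddCircle) : circleRep x ∈ Set.Ico (0 : ℝ) 1 := by
  simpa only [zero_add, circleRep] using (AddCircle.equivIco (1 : ℝ) 0 x).2

theorem coe_circleRep (x : UnitAddCircle) : (circleRep x : UnitAddCircle) = x :=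
  AddCircle.coe_equivIco

theorem circleRep_injective : Function.Injective circleRep :=
  Function.LeftInverse.injective (g := fun x : ℝ ↦ (x : UnitAddCircle)) coe_circleRep

theorem circleRep_coe {x : ℝ} (hx : x ∈ Set.Ico (0 : ℝ) 1) : circleRep (x : UnitAddCircle) = x := by
  have hx' : x ∈ Set.Ico (0 : ℝ) (0 + 1) := by simpa using hx
  exact congrArg Subtype.val (AddCircle.equivIco_coe_eq (p := (1 : ℝ)) (a := 0) hx')

theorem measurable_circleRep : Measurable circleRep :=
  measurable_subtype_coe.comp (AddCircle.measurableEquivIco 1 0).measurable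

theorem circleRep_sub (a b : UnitAddCircle) :
    circleRep (b - a) =
      circleRep b - circleRep a + if circleRep b < circleRep a then 1 else 0 := by
  obtain ⟨ha0, ha1⟩ := circleRep_mem_Ico a
  obtain ⟨hb0, hb1⟩ := circleRep_mem_Ico b
  have hcoe : ((circleRep b - circleRep a : ℝ) : UnitAddCircle) = b - a := by
    rw [AddCircle.coe_sub, coe_circleRep, coe_circleRep]
  split_ifs with hlt
  · rw [← hcoe, ← add_zero ((circleRep b - circleRep a : ℝ) : UnitAddCircle),
      ← AddCircle.coe_period 1, ← AddCircle.coe_add]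
    exact circleRep_coe ⟨by linarith, by linarith⟩
  · rw [← hcoe, add_zero]
    exact circleRep_coe ⟨by linarith, by linarith⟩

theorem memLp_circleRep : MemLp circleRep 2 volume :=
  MemLp.of_bound measurable_circleRep.aestronglyMeasurable 1 <| .of_forall fun x ↦ by
    rw [Real.norm_of_nonneg (circleRep_mem_Ico x).1]
    exact (circleRep_mem_Ico x).2.le

theorem variance_circleRep_pos : 0 < Var[circleRep; volume] := by
  refine (variance_nonneg _ _).lt_of_ne' fun h ↦ ?_
  have hae := ae_eq_integral_of_variance_eq_zero memLp_circleRep h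
  have hne : ∀ᵐ x, circleRep x ≠ ∫ x, circleRep x :=
    Set.Subsingleton.measure_zero (fun x hx y hy ↦ circleRep_injective <|
      (not_not.1 hx).trans (not_not.1 hy).symm) volume
  obtain ⟨x, hx, hx'⟩ := (hae.and hne).exists
  exact hx' hx

instance isProbabilityMeasure_map_circleRep :
    IsProbabilityMeasure ((volume : Measure UnitAddCircle).map circleRep) :=
  Measure.isProbabilityMeasure_map measurable_circleRep.aemeasurable

instance nullSingletonClass_map_circleRep :
    NullSingletonClass ((volume : Measure UnitAddCircle).map circleRep) where
  measure_singleton x := by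
    rw [Measure.map_apply measurable_circleRep (measurableSet_singleton x)]
    exact (Set.subsingleton_singleton.preimage circleRep_injective).measure_zero volume

theorem sum_circleRep_finRotate_sub {n : ℕ} (V : Fin n → UnitAddCircle) :
    ∑ i, circleRep (V (finRotate n i) - V i) = cyclicDescents (circleRep ∘ V) := by
  simp only [circleRep_sub, Finset.sum_add_distrib, Finset.sum_sub_distrib]
  rw [Equiv.sum_comp (finRotate n) fun i ↦ circleRep (V i), sub_self, zero_add, Finset.sum_boole]
  rfl

/-- The representatives in `[0, 1)` of the first `n` partial sums of a sequence in `ℝ / ℤ`. -/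
noncomputable def partialSumReps (u : ℕ → UnitAddCircle) (n : ℕ) (i : Fin n) : ℝ :=
  circleRep (∑ k ∈ Finset.range (i + 1), u k)

theorem abs_cyclicDescents_partialSumReps_sub_le (u : ℕ → UnitAddCircle) (n : ℕ) :
    |(cyclicDescents (partialSumReps u n) : ℝ) - ∑ k ∈ Finset.range n, circleRep (u k)| ≤ 1 := by
  obtain - | m := n
  · simp [cyclicDescents]
  have hcyc : _ = (cyclicDescents (partialSumReps u (m + 1)) : ℝ) :=
    sum_circleRep_finRotate_sub fun i : Fin (m + 1) ↦ ∑ k ∈ Finset.range (i + 1), u k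
  have hlast := circleRep_mem_Ico (u 0 - ∑ k ∈ Finset.range (m + 1), u k)
  have hfirst := circleRep_mem_Ico (u 0)
  rw [Fin.sum_univ_castSucc] at hcyc
  simp only [finRotate_apply, Fin.coeSucc_eq_succ, Fin.last_add_one, Fin.val_succ,
    Fin.val_castSucc, Fin.val_last, Fin.val_zero, zero_add, Finset.sum_range_one,
    Finset.sum_range_succ_sub_sum] at hcyc
  rw [Fin.sum_univ_eq_sum_range fun k ↦ circleRep (u (k + 1))] at hcyc
  rw [← hcyc, Finset.sum_range_succ' fun k ↦ circleRep (u k), add_sub_add_left_eq_sub, abs_le]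
  exact ⟨by linarith [hlast.1, hfirst.2], by linarith [hlast.2, hfirst.1]⟩

end Circle

section Coupling

open Equiv
open scoped BigOperators

/-- The cycle obtained by merging the cycles of the rank permutation of the partial sums of `u`
on the circle. -/
noncomputable def coupledCycle (u : ℕ → UnitAddCircle) (m : ℕ) : NCycle (m + 1) :=
  (mergeCycles m (rank (partialSumReps u (m + 1)))).2

theorem abs_degreeRV_coupledCycle_sub_le (u : ℕ → UnitAddCircle) (m : ℕ)
    (hu : Function.Injective (partialSumReps u (m + 1))) :
    |degreeRV (m + 1) (coupledCycle u m) - ∑ k ∈ Finset.range (m + 1), circleRep (u k)| ≤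
      2 * mergeDist m (rank (partialSumReps u (m + 1))) + 1 := by
  have hmerge := abs_cyclicDescents_sub_le (coupledCycle u m).1 (rank (partialSumReps u (m + 1)))
  rw [hammingDist_comm, cyclicDescents_rank hu] at hmerge
  exact (abs_sub_le _ _ _).trans
    (add_le_add hmerge (abs_cyclicDescents_partialSumReps_sub_le u (m + 1)))

variable {Ω : Type*} {mΩ : MeasurableSpace Ω} {P : Measure Ω} {u : ℕ → Ω → UnitAddCircle}

theorem hasLaw_partialSumReps (hu : ∀ k, HasLaw (u k) volume P) (hindep : iIndepFun u P) (n : ℕ) :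
    HasLaw (fun ω ↦ partialSumReps (u · ω) n)
      (Measure.pi fun _ ↦ (volume : Measure UnitAddCircle).map circleRep) P :=
  (measurePreserving_pi _ _ fun _ ↦ measurable_circleRep.measurePreserving volume).comp_hasLaw
    (hasLaw_partialSums hu hindep n)

theorem ae_injective_partialSumReps (hu : ∀ k, HasLaw (u k) volume P) (hindep : iIndepFun u P)
    (n : ℕ) : ∀ᵐ ω ∂P, Function.Injective (partialSumReps (u · ω) n) := by
  have hlaw := hasLaw_partialSumReps hu hindep n
  have hinj := ae_injective_pi (ι := Fin n) ((volume : Measure UnitAddCircle).map circleRep)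
  rw [← hlaw.map_eq] at hinj
  exact ae_of_ae_map hlaw.aemeasurable hinj

theorem hasLaw_rank_partialSumReps (hu : ∀ k, HasLaw (u k) volume P) (hindep : iIndepFun u P)
    (n : ℕ) : HasLaw (fun ω ↦ rank (partialSumReps (u · ω) n)) (uniformOn Set.univ) P :=
  (measurePreserving_rank _).comp_hasLaw (hasLaw_partialSumReps hu hindep n)

theorem hasLaw_coupledCycle (hu : ∀ k, HasLaw (u k) volume P) (hindep : iIndepFun u P) (m : ℕ) :
    HasLaw (fun ω ↦ coupledCycle (u · ω) m) (uniformNCycle (m + 1)) P :=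
  (measurePreserving_snd_comp_equiv (mergeCycles m)).comp_hasLaw
    (hasLaw_rank_partialSumReps hu hindep (m + 1))

theorem identDistrib_degreeRV_coupledCycle (hu : ∀ k, HasLaw (u k) volume P)
    (hindep : iIndepFun u P) (m : ℕ) :
    IdentDistrib (fun ω ↦ degreeRV (m + 1) (coupledCycle (u · ω) m)) (degreeRV (m + 1)) P
      (uniformNCycle (m + 1)) :=
  ((hasLaw_coupledCycle hu hindep m).identDistrib .id).comp (u := degreeRV (m + 1)) .of_discrete

theorem memLp_degreeRV_coupledCycle (hu : ∀ k, HasLaw (u k) volume P) (hindep : iIndepFun u P)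
    (m : ℕ) : MemLp (fun ω ↦ degreeRV (m + 1) (coupledCycle (u · ω) m)) 2 P :=
  (identDistrib_degreeRV_coupledCycle hu hindep m).memLp_iff.2 .of_discrete

theorem identDistrib_circleRep (hu : ∀ k, HasLaw (u k) volume P) (k : ℕ) :
    IdentDistrib (fun ω ↦ circleRep (u k ω)) circleRep P volume :=
  ((hu k).identDistrib .id).comp measurable_circleRep

theorem memLp_sum_circleRep (hu : ∀ k, HasLaw (u k) volume P) (n : ℕ) :
    MemLp (fun ω ↦ ∑ k ∈ Finset.range n, circleRep (u k ω)) 2 P :=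
  memLp_finsetSum _ fun k _ ↦ (identDistrib_circleRep hu k).memLp_iff.2 memLp_circleRep

theorem variance_degreeRV_coupledCycle_sub_le (hu : ∀ k, HasLaw (u k) volume P)
    (hindep : iIndepFun u P) (m : ℕ) :
    Var[(fun ω ↦ degreeRV (m + 1) (coupledCycle (u · ω) m)) -
        fun ω ↦ ∑ k ∈ Finset.range (m + 1), circleRep (u k ω); P] ≤
      32 * (harmonic (m + 1) + 1) ^ 2 + 2 := by
  have := (hu 0).isProbabilityMeasure
  have hrank := hasLaw_rank_partialSumReps hu hindep (m + 1)
  have hsub := (memLp_degreeRV_coupledCycle hu hindep m).sub (memLp_sum_circleRep hu (m + 1))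
  have hdist : MemLp (fun ω ↦ (mergeDist m (rank (partialSumReps (u · ω) (m + 1))) : ℝ)) 2 P :=
    ((hrank.identDistrib .id).comp (u := fun σ ↦ (mergeDist m σ : ℝ)) .of_discrete).memLp_iff.2
      .of_discrete
  have hsecond : ∫ ω, (mergeDist m (rank (partialSumReps (u · ω) (m + 1))) : ℝ) ^ 2 ∂P =
      𝔼 σ, (mergeDist m σ : ℝ) ^ 2 :=
    (hrank.integral_comp (f := fun σ ↦ (mergeDist m σ : ℝ) ^ 2)
      Measurable.of_discrete.aestronglyMeasurable).trans (integral_uniformOn_univ _)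
  have hvar := variance_le_of_abs_le_two_mul_add_one hsub.aestronglyMeasurable hdist <|
    (ae_injective_partialSumReps hu hindep (m + 1)).mono fun ω hω ↦
      abs_degreeRV_coupledCycle_sub_le (u · ω) m hω
  rw [hsecond] at hvar
  linarith [expect_mergeDist_sq_le m]

end Coupling

section CentralLimit

variable {Ω : Type*} {mΩ : MeasurableSpace Ω} {P : Measure Ω} {u : ℕ → Ω → UnitAddCircle}

theorem variance_sum_circleRep (hu : ∀ k, HasLaw (u k) volume P) (hindep : iIndepFun u P)
    (n : ℕ) :
    Var[fun ω ↦ ∑ k ∈ Finset.range n, circleRep (u k ω); P] = n * Var[circleRep; volume] := by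
  have hident := identDistrib_circleRep hu
  rw [variance_sum_of_iid (X := fun k ω ↦ circleRep (u k ω))
    ((hident 0).memLp_iff.2 memLp_circleRep) (hindep.comp _ fun _ ↦ measurable_circleRep)
    fun k ↦ (hident k).trans (hident 0).symm, (hident 0).variance_eq]

theorem tendsto_variance_degreeRV_coupledCycle_sub_div (hu : ∀ k, HasLaw (u k) volume P)
    (hindep : iIndepFun u P) :
    Tendsto (fun m : ℕ ↦ Var[(fun ω ↦ degreeRV (m + 1) (coupledCycle (u · ω) m)) -
        fun ω ↦ ∑ k ∈ Finset.range (m + 1), circleRep (u k ω); P] /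
      Var[fun ω ↦ ∑ k ∈ Finset.range (m + 1), circleRep (u k ω); P]) atTop (nhds 0) := by
  have hharm := ((tendsto_add_atTop_iff_nat 1).2 tendsto_harmonic_add_one_sq_div).const_mul
    (34 / Var[circleRep; volume])
  rw [mul_zero] at hharm
  refine squeeze_zero (fun m ↦ div_nonneg (variance_nonneg _ _) (variance_nonneg _ _))
    (fun m ↦ ?_) hharm
  have hone : 1 ≤ ((harmonic (m + 1) : ℝ) + 1) ^ 2 := by nlinarith [harmonic_nonneg (m + 1)]
  rw [variance_sum_circleRep hu hindep, div_mul_div_comm, mul_comm (Var[circleRep; volume])]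
  gcongr
  · exact mul_nonneg (Nat.cast_nonneg _) variance_circleRep_pos.le
  · linarith [variance_degreeRV_coupledCycle_sub_le hu hindep m]

variable [IsProbabilityMeasure P] {Ω' : Type*} {mΩ' : MeasurableSpace Ω'} {Q : Measure Ω'}
  [IsProbabilityMeasure Q] {Z : Ω' → ℝ}

theorem tendstoInDistribution_standardize_sum_circleRep (hZ : HasLaw Z (gaussianReal 0 1) Q)
    (hu : ∀ k, HasLaw (u k) volume P) (hindep : iIndepFun u P) :
    TendstoInDistribution
      (fun n : ℕ ↦ standardize P fun ω ↦ ∑ k ∈ Finset.range n, circleRep (u k ω))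
      atTop Z (fun _ ↦ P) Q := by
  have hident := identDistrib_circleRep hu
  refine tendstoInDistribution_standardize_sum (X := fun k ω ↦ circleRep (u k ω)) hZ
    ((hident 0).memLp_iff.2 memLp_circleRep) ?_ (hindep.comp _ fun _ ↦ measurable_circleRep)
    fun k ↦ (hident k).trans (hident 0).symm
  rw [(hident 0).variance_eq]
  exact variance_circleRep_pos

theorem tendstoInDistribution_standardize_degreeRV_coupledCycle
    (hZ : HasLaw Z (gaussianReal 0 1) Q) (hu : ∀ k, HasLaw (u k) volume P)
    (hindep : iIndepFun u P) :
    TendstoInDistribution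
      (fun m ↦ standardize P fun ω ↦ degreeRV (m + 1) (coupledCycle (u · ω) m))
      atTop Z (fun _ ↦ P) Q := by
  refine tendstoInDistribution_standardize_of_variance_sub
    (memLp_degreeRV_coupledCycle hu hindep) (fun m ↦ memLp_sum_circleRep hu (m + 1))
    (.of_forall fun m ↦ ?_) (tendsto_variance_degreeRV_coupledCycle_sub_div hu hindep) ?_
  · rw [variance_sum_circleRep hu hindep]
    exact mul_pos (Nat.cast_pos.2 m.succ_pos) variance_circleRep_pos
  · have hsum := tendstoInDistribution_standardize_sum_circleRep hZ hu hindep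
    exact ⟨fun m ↦ hsum.forall_aemeasurable (m + 1), hsum.aemeasurable_limit,
      (tendsto_add_atTop_iff_nat 1).2 hsum.tendsto⟩

end CentralLimit

theorem mainTheorem3 :
    TendstoInDistribution normalizedDegree atTop (id : ℝ → ℝ) uniformNCycle (gaussianReal 0 1) := by
  obtain ⟨Ω, _, P, u, -, hu, hindep, _⟩ := exists_iid ℕ (volume : Measure UnitAddCircle)
  have hident : ∀ m, IdentDistrib
      (standardize P fun ω ↦ degreeRV (m + 1) (coupledCycle (u · ω) m))
      (normalizedDegree (m + 1)) P (uniformNCycle (m + 1)) := fun m ↦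
    identDistrib_standardize (identDistrib_degreeRV_coupledCycle hu hindep m)
  have hlim := tendstoInDistribution_of_forall_identDistrib hident
    (tendstoInDistribution_standardize_degreeRV_coupledCycle .id hu hindep)
  exact ⟨fun _ ↦ Measurable.of_discrete.aemeasurable, aemeasurable_id,
    (tendsto_add_atTop_iff_nat 1).1 hlim.tendsto⟩
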